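/- Lemma (Oliveira bound). Let $N,d\ge 0$ be integers, let $A^{(1)},\dots,A^{(N)}$ be fixed $d\times d$ complex Hermitian matrices, and let $\epsilon_1,\dots,\epsilon_N$ be independent real random variables, each of which is either a Rademacher variable (taking the values $1$ and $-1$ with probability $\tfrac12$ each) or a standard Gaussian variable. Put $Z^{(N)}=\sum_{p=1}^N \epsilon_p A^{(p)}$. Then for every $\mu\in\mathbb R$ the random variable ${\rm Tr}\,e^{\mu Z^{(N)}}$ is integrable, and $$\mathbb E\,\big({\rm Tr}\,e^{\mu Z^{(N)}}\big)\le {\rm Tr}\,\Big(e^{\frac{\mu^2}{2}\sum_{p=1}^N (A^{(p)})^2}\Big);$$ also $$\mathbb E\,\big({\rm Tr}\,e^{\mu Z^{(N)}}\big)\le {\rm Tr}\,\Big(e^{\mu^2\sum_{p=1}^N (A^{(p)})^2}\Big).$$ -/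

import Mathlib

open MeasureTheory ProbabilityTheory
open scoped ComplexOrder ENNReal

/-- The Rademacher distribution: the values `1` and `-1`, each with probability `1/2`. -/
noncomputable def rademacherLaw : Measure ℝ :=
  (2⁻¹ : ℝ≥0∞) • Measure.dirac 1 + (2⁻¹ : ℝ≥0∞) • Measure.dirac (-1)

/-- The random matrix `Z = ∑ p, ε p • A p`, as a function of the sample point. -/
noncomputable def matrixSum {Ω : Type*} {N d : ℕ} (ε : Fin N → Ω → ℝ)
    (A : Fin N → Matrix (Fin d) (Fin d) ℂ) (ω : Ω) : Matrix (Fin d) (Fin d) ℂ :=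
  ∑ p, ε p ω • A p

/-! Compensate each summand: subtracting half its square makes the trace exponential a
supermartingale. By Golden–Thompson, Tr exp(H + (xA - A²/2)) ≤ Tr(exp H · exp(xA - A²/2)). The
second factor is a function of A alone, so in an eigenbasis of A the average over x reduces to the
scalar bound E exp(xa - a²/2) ≤ 1, which is E exp(tx) ≤ exp(t²/2) at t = a. Integrating out the
variables one at a time leaves Tr exp H. Starting from H = (μ²/2) ∑ A_p², with μ A_p as summands,
the compensators cancel H and only μ Z remains in the exponent. -/

/-! ### The Lie product formula. -/

theorem norm_exp_le_exp_norm {𝔸 : Type*} [NormedRing 𝔸] [NormOneClass 𝔸] [NormedAlgebra ℝ 𝔸]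
    [CompleteSpace 𝔸] (x : 𝔸) : ‖NormedSpace.exp x‖ ≤ Real.exp ‖x‖ := by
  rw [NormedSpace.exp_eq_tsum ℝ, Real.exp_eq_exp_ℝ, NormedSpace.exp_eq_tsum ℝ]
  refine tsum_of_norm_bounded (NormedSpace.expSeries_summable' (𝕂 := ℝ) ‖x‖).hasSum fun n => ?_
  rw [norm_smul, smul_eq_mul]
  have h : ‖((n.factorial : ℝ)⁻¹)‖ = (n.factorial : ℝ)⁻¹ := by simp
  rw [h]
  gcongr
  exact norm_pow_le x n

theorem norm_pow_sub_pow_le {𝔸 : Type*} [NormedRing 𝔸] [NormOneClass 𝔸] {a b : 𝔸} {M : ℝ}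
    (ha : ‖a‖ ≤ M) (hb : ‖b‖ ≤ M) (hM : 1 ≤ M) (n : ℕ) :
    ‖a ^ n - b ^ n‖ ≤ n * M ^ n * ‖a - b‖ := by
  induction n with
  | zero => simp
  | succ n ih =>
    have h : a ^ (n + 1) - b ^ (n + 1) = a ^ n * (a - b) + (a ^ n - b ^ n) * b := by
      rw [pow_succ, pow_succ]; noncomm_ring
    have h0 : (0 : ℝ) ≤ M := by linarith
    have h1 : ‖a ^ n‖ ≤ M ^ n := (norm_pow_le a n).trans (by gcongr)
    have h2 : M ^ n ≤ M ^ (n + 1) := pow_le_pow_right₀ hM (Nat.le_succ n)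
    calc ‖a ^ (n + 1) - b ^ (n + 1)‖
        ≤ ‖a ^ n‖ * ‖a - b‖ + ‖a ^ n - b ^ n‖ * ‖b‖ := by
          rw [h]
          exact (norm_add_le _ _).trans (add_le_add (norm_mul_le _ _) (norm_mul_le _ _))
      _ ≤ M ^ (n + 1) * ‖a - b‖ + (n * M ^ n * ‖a - b‖) * M := by
          gcongr
          exact h1.trans h2
      _ = ((n + 1 : ℕ) : ℝ) * M ^ (n + 1) * ‖a - b‖ := by push_cast; ring

open Filter Topology in
/-- The **Lie product formula**. -/
theorem tendsto_exp_mul_exp_pow {𝔸 : Type*} [NormedRing 𝔸] [NormOneClass 𝔸] [NormedAlgebra ℝ 𝔸]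
    [CompleteSpace 𝔸] (x y : 𝔸) :
    Tendsto (fun n : ℕ => (NormedSpace.exp ((n : ℝ)⁻¹ • x) * NormedSpace.exp ((n : ℝ)⁻¹ • y)) ^ n)
      atTop (𝓝 (NormedSpace.exp (x + y))) := by
  have hx := hasDerivAt_exp_smul_const (𝕂 := ℝ) x 0
  have hy := hasDerivAt_exp_smul_const (𝕂 := ℝ) y 0
  have hxy := hasDerivAt_exp_smul_const (𝕂 := ℝ) (x + y) 0
  have hd := (hx.mul hy).sub hxy
  -- The two curves agree to first order at 0, so n times their difference at t = 1/n tends to 0.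
  -- Passing to n-th powers costs a factor n and a constant, exp(‖x‖ + ‖y‖).
  have hd0 : HasDerivAt (fun t : ℝ => NormedSpace.exp (t • x) * NormedSpace.exp (t • y)
      - NormedSpace.exp (t • (x + y))) 0 0 := by
    convert! hd using 1
    simp
  have hs : Tendsto (fun n : ℕ => (n : ℝ)⁻¹) atTop (𝓝[≠] 0) := by
    refine tendsto_nhdsWithin_iff.2 ⟨tendsto_inv_atTop_nhds_zero_nat, ?_⟩
    filter_upwards [eventually_ge_atTop 1] with n hn
    simp; omega
  have hslope := (hasDerivAt_iff_tendsto_slope.1 hd0).comp hs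
  have hlim := (hslope.norm.const_mul (Real.exp (‖x‖ + ‖y‖)))
  rw [norm_zero, mul_zero] at hlim
  refine tendsto_iff_norm_sub_tendsto_zero.2 (squeeze_zero' (Eventually.of_forall fun _ =>
    norm_nonneg _) ?_ hlim)
  filter_upwards [eventually_ge_atTop 1] with n hn
  have hn0 : (n : ℝ) ≠ 0 := by positivity
  have hpow : NormedSpace.exp (x + y) = NormedSpace.exp ((n : ℝ)⁻¹ • (x + y)) ^ n := by
    let _ : NormedAlgebra ℚ 𝔸 := NormedAlgebra.restrictScalars ℚ ℝ 𝔸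
    rw [← NormedSpace.exp_nsmul, ← Nat.cast_smul_eq_nsmul ℝ, smul_smul, mul_inv_cancel₀ hn0,
      one_smul]
  have hM : Real.exp (‖x‖ + ‖y‖) = Real.exp ((n : ℝ)⁻¹ * (‖x‖ + ‖y‖)) ^ n := by
    rw [← Real.exp_nat_mul, mul_inv_cancel_left₀ hn0]
  have hb (z : 𝔸) : ‖NormedSpace.exp ((n : ℝ)⁻¹ • z)‖ ≤ Real.exp ((n : ℝ)⁻¹ * ‖z‖) := by
    refine (norm_exp_le_exp_norm _).trans_eq ?_
    rw [norm_smul, norm_inv, Real.norm_natCast]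
  have h1 : ‖NormedSpace.exp ((n : ℝ)⁻¹ • x) * NormedSpace.exp ((n : ℝ)⁻¹ • y)‖
      ≤ Real.exp ((n : ℝ)⁻¹ * (‖x‖ + ‖y‖)) := by
    rw [mul_add, Real.exp_add]
    exact (norm_mul_le _ _).trans (by gcongr <;> apply hb)
  have h2 : ‖NormedSpace.exp ((n : ℝ)⁻¹ • (x + y))‖ ≤ Real.exp ((n : ℝ)⁻¹ * (‖x‖ + ‖y‖)) := by
    refine (hb _).trans ?_
    gcongr
    exact norm_add_le x y
  rw [hpow]
  refine (norm_pow_sub_pow_le h1 h2 (Real.one_le_exp (by positivity)) n).trans_eq ?_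
  rw [← hM]
  simp only [Function.comp_apply, slope_def_module, zero_smul, NormedSpace.exp_zero, mul_one,
    sub_self, sub_zero, norm_smul, inv_inv, Real.norm_natCast]
  ring

/-! ### The Golden–Thompson inequality. -/

namespace Matrix

/-- Expand Tr (Mᴴ - N)ᴴ(Mᴴ - N) ≥ 0. -/
theorem re_trace_mul_le {n : Type*} [Fintype n] (M N : Matrix n n ℂ) :
    (M * N).trace.re ≤ ((M * Mᴴ).trace.re + (N * Nᴴ).trace.re) / 2 := by
  have h : (M * Mᴴ + N * Nᴴ - 2 • (M * N)).trace.re =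
      ((Mᴴ - N)ᴴ * (Mᴴ - N)).trace.re := by
    have h1 : (Nᴴ * Mᴴ).trace.re = (M * N).trace.re := by
      rw [← conjTranspose_mul, trace_conjTranspose]; simp
    have h2 : (Nᴴ * N).trace = (N * Nᴴ).trace := trace_mul_comm _ _
    simp only [conjTranspose_sub, conjTranspose_conjTranspose, Matrix.sub_mul, Matrix.mul_sub,
      trace_sub, trace_add, trace_smul, Complex.sub_re, Complex.add_re, h1, h2]
    simp
    ring
  have h3 := (Complex.le_def.1 (posSemidef_conjTranspose_mul_self (Mᴴ - N)).trace_nonneg).1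
  rw [← h] at h3
  simp at h3
  linarith

variable {n : Type*} [Fintype n] [DecidableEq n]

theorem trace_mul_pow_comm {R : Type*} [CommSemiring R] (U V : Matrix n n R) (k : ℕ) :
    ((U * V) ^ k).trace = ((V * U) ^ k).trace := by
  cases k with
  | zero => simp
  | succ k =>
    have h : (U * V) ^ (k + 1) = U * ((V * U) ^ k * V) := by
      induction k with
      | zero => simp
      | succ k ih => rw [pow_succ, ih, pow_succ]; simp only [Matrix.mul_assoc]
    rw [h, trace_mul_comm, Matrix.mul_assoc, ← pow_succ]

/-- The two claims feed each other, hence the joint induction. For the first, apply it to M²: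
cyclicity turns M²(M²)ᴴ into (MᴴM)(MMᴴ), the second claim splits the power, and `re_trace_mul_le`
merges the factors, whose powers have equal traces. For the second, apply the first to XY: cyclicity
turns XY²X into X²Y². -/
theorem re_trace_pow_two_pow_le (k : ℕ) :
    (∀ M : Matrix n n ℂ, (M ^ 2 ^ (k + 1)).trace.re ≤ ((M * Mᴴ) ^ 2 ^ k).trace.re) ∧
    (∀ X Y : Matrix n n ℂ, X.IsHermitian → Y.IsHermitian →
      ((X * Y) ^ 2 ^ k).trace.re ≤ (X ^ 2 ^ k * Y ^ 2 ^ k).trace.re) := by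
  induction k with
  | zero =>
    refine ⟨fun M => ?_, fun X Y _ _ => by simp⟩
    have := re_trace_mul_le M M
    simp [pow_two]
    linarith
  | succ k ih =>
    obtain ⟨ihA, ihB⟩ := ih
    refine ⟨fun M => ?_, fun X Y hX hY => ?_⟩
    · have hP := isHermitian_conjTranspose_mul_self M
      have hQ := isHermitian_mul_conjTranspose_self M
      have h1 := ihA (M ^ 2)
      rw [← pow_mul, ← pow_succ'] at h1
      have h2 : M ^ 2 * (M ^ 2)ᴴ = (M * (M * Mᴴ)) * Mᴴ := by
        simp only [pow_two, conjTranspose_mul, Matrix.mul_assoc]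
      rw [h2, trace_mul_pow_comm, ← Matrix.mul_assoc] at h1
      have h3 := re_trace_mul_le ((Mᴴ * M) ^ 2 ^ k) ((M * Mᴴ) ^ 2 ^ k)
      rw [(hP.pow _).eq, (hQ.pow _).eq, ← pow_two, ← pow_two, ← pow_mul, ← pow_mul, ← pow_succ,
        trace_mul_pow_comm] at h3
      have h4 := ihB _ _ hP hQ
      linarith
    · have h1 := ihA (X * Y)
      have h2 : (X * Y) * (X * Y)ᴴ = X * (Y ^ 2 * X) := by
        simp only [pow_two, conjTranspose_mul, hX.eq, hY.eq, Matrix.mul_assoc]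
      rw [h2, trace_mul_pow_comm X (Y ^ 2 * X), Matrix.mul_assoc, ← pow_two,
        trace_mul_pow_comm (Y ^ 2)] at h1
      have h3 := ihB _ _ (hX.pow 2) (hY.pow 2)
      rw [← pow_mul, ← pow_mul, ← pow_succ'] at h3
      linarith

open Filter Topology in
/-- The **Golden–Thompson inequality**. -/
theorem re_trace_exp_add_le {X Y : Matrix n n ℂ} (hX : X.IsHermitian) (hY : Y.IsHermitian) :
    (NormedSpace.exp (X + Y)).trace.re ≤ (NormedSpace.exp X * NormedSpace.exp Y).trace.re := by
  -- `NormOneClass` for matrices needs a nonempty index type.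
  cases isEmpty_or_nonempty n
  · simp [Matrix.trace]
  have hlie : Tendsto (fun k : ℕ => (NormedSpace.exp ((k : ℝ)⁻¹ • X) *
      NormedSpace.exp ((k : ℝ)⁻¹ • Y)) ^ k) atTop (𝓝 (NormedSpace.exp (X + Y))) := by
    let _ : NormedRing (Matrix n n ℂ) := Matrix.linftyOpNormedRing
    let _ : NormedAlgebra ℝ (Matrix n n ℂ) := Matrix.linftyOpNormedAlgebra
    have : NormOneClass (Matrix n n ℂ) := Matrix.linfty_opNormOneClass
    exact tendsto_exp_mul_exp_pow X Y
  have hre : Continuous fun M : Matrix n n ℂ => M.trace.re :=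
    Complex.continuous_re.comp continuous_id.matrix_trace
  have hpow : Tendsto (fun k : ℕ => 2 ^ k) atTop atTop :=
    tendsto_pow_atTop_atTop_of_one_lt one_lt_two
  refine le_of_tendsto ((hre.tendsto _).comp (hlie.comp hpow)) (Eventually.of_forall fun k => ?_)
  have hherm {Z : Matrix n n ℂ} (hZ : Z.IsHermitian) :
      (NormedSpace.exp (((2 ^ k : ℕ) : ℝ)⁻¹ • Z)).IsHermitian :=
    (hZ.smul (IsSelfAdjoint.all _)).exp
  have hp (Z : Matrix n n ℂ) :
      NormedSpace.exp (((2 ^ k : ℕ) : ℝ)⁻¹ • Z) ^ 2 ^ k = NormedSpace.exp Z := by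
    rw [← Matrix.exp_nsmul, ← Nat.cast_smul_eq_nsmul ℝ, smul_smul, mul_inv_cancel₀ (by positivity),
      one_smul]
  have h := (re_trace_pow_two_pow_le k).2 _ _ (hherm hX) (hherm hY)
  rwa [hp, hp] at h

/-! ### Exponentials of Hermitian matrices and their traces. -/

theorem IsHermitian.real_smul {n : Type*} {A : Matrix n n ℂ} (hA : A.IsHermitian) (t : ℝ) :
    (t • A).IsHermitian :=
  hA.smul (IsSelfAdjoint.all t)

theorem IsHermitian.sum {n ι : Type*} (s : Finset ι) {A : ι → Matrix n n ℂ}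
    (hA : ∀ p, (A p).IsHermitian) : (∑ p ∈ s, A p).IsHermitian := by
  simp only [IsHermitian, conjTranspose_sum, (hA _).eq]

theorem continuous_re_trace_exp :
    Continuous fun M : Matrix n n ℂ => (NormedSpace.exp M).trace.re := by
  have h : Continuous fun M : Matrix n n ℂ => NormedSpace.exp M := by
    let _ : NormedRing (Matrix n n ℂ) := Matrix.linftyOpNormedRing
    let _ : NormedAlgebra ℝ (Matrix n n ℂ) := Matrix.linftyOpNormedAlgebra
    let _ : NormedAlgebra ℚ (Matrix n n ℂ) := NormedAlgebra.restrictScalars ℚ ℝ _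
    have : CompleteSpace (Matrix n n ℂ) := FiniteDimensional.complete ℝ _
    exact NormedSpace.exp_continuous
  exact Complex.continuous_re.comp h.matrix_trace

theorem IsHermitian.posSemidef_exp {A : Matrix n n ℂ} (hA : A.IsHermitian) :
    (NormedSpace.exp A).PosSemidef := by
  have hB := (hA.real_smul 2⁻¹).exp
  have h : NormedSpace.exp A = NormedSpace.exp ((2⁻¹ : ℝ) • A) *
      (NormedSpace.exp ((2⁻¹ : ℝ) • A))ᴴ := by
    rw [hB.eq, ← exp_add_of_commute _ _ (Commute.refl _), ← add_smul]
    norm_num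
  rw [h]
  exact posSemidef_self_mul_conjTranspose _

theorem IsHermitian.trace_exp_eq_re {A : Matrix n n ℂ} (hA : A.IsHermitian) :
    (NormedSpace.exp A).trace = ((NormedSpace.exp A).trace.re : ℂ) := by
  have h := (Complex.le_def.1 hA.posSemidef_exp.trace_nonneg).2
  exact Complex.ext (by simp) (by simpa using h.symm)

theorem IsHermitian.re_trace_exp_nonneg {A : Matrix n n ℂ} (hA : A.IsHermitian) :
    0 ≤ (NormedSpace.exp A).trace.re :=
  (Complex.le_def.1 hA.posSemidef_exp.trace_nonneg).1

theorem IsHermitian.exp_quadratic_eq {A : Matrix n n ℂ} (hA : A.IsHermitian) (s t : ℝ) :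
    NormedSpace.exp (s • A + t • A ^ 2) = (hA.eigenvectorUnitary : Matrix n n ℂ) *
      diagonal (fun i => (Real.exp (s * hA.eigenvalues i + t * hA.eigenvalues i ^ 2) : ℂ)) *
        (hA.eigenvectorUnitary : Matrix n n ℂ)ᴴ := by
  set U : Matrix n n ℂ := (hA.eigenvectorUnitary : Matrix n n ℂ) with hU
  have h1 : Uᴴ * U = 1 := Unitary.coe_star_mul_self hA.eigenvectorUnitary
  have h2 : U * Uᴴ = 1 := Unitary.coe_mul_star_self hA.eigenvectorUnitary
  have hinv : U⁻¹ = Uᴴ := inv_eq_left_inv h1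
  have hspec : A = U * diagonal (fun i => (hA.eigenvalues i : ℂ)) * Uᴴ := by
    have := hA.spectral_theorem
    rwa [Unitary.conjStarAlgAut_apply] at this
  have hsq : A ^ 2 = U * diagonal (fun i => (hA.eigenvalues i : ℂ) ^ 2) * Uᴴ := by
    calc A ^ 2 = U * diagonal (fun i => (hA.eigenvalues i : ℂ)) * (Uᴴ * U) *
          diagonal (fun i => (hA.eigenvalues i : ℂ)) * Uᴴ := by
          rw [pow_two]
          conv_lhs => rw [hspec]
          simp only [Matrix.mul_assoc]
      _ = _ := by
          rw [h1, Matrix.mul_one, Matrix.mul_assoc U, diagonal_mul_diagonal]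
          simp only [pow_two]
  have hcomb : s • A + t • A ^ 2 = U * diagonal
      (fun i => ((s * hA.eigenvalues i + t * hA.eigenvalues i ^ 2 : ℝ) : ℂ)) * U⁻¹ := by
    have hd : diagonal (fun i => ((s * hA.eigenvalues i + t * hA.eigenvalues i ^ 2 : ℝ) : ℂ)) =
        s • diagonal (fun i => (hA.eigenvalues i : ℂ)) +
          t • diagonal (fun i => (hA.eigenvalues i : ℂ) ^ 2) := by
      rw [← diagonal_smul, ← diagonal_smul, diagonal_add]
      congr 1; ext i; simp
    rw [hd, hsq, hinv, Matrix.mul_add, Matrix.add_mul, Matrix.mul_smul, Matrix.mul_smul,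
      Matrix.smul_mul, Matrix.smul_mul, ← hspec]
  rw [hcomb, exp_conj _ _ (IsUnit.of_mul_eq_one Uᴴ h2), exp_diagonal, hinv]
  congr 3
  ext i
  rw [Pi.coe_exp, Complex.ofReal_exp, Complex.exp_eq_exp_ℂ]

/-- The weights are the diagonal entries of Q in an eigenbasis of A. They do not depend on s and t,
so averaging over s becomes a scalar problem. -/
theorem IsHermitian.re_trace_mul_exp_quadratic {A : Matrix n n ℂ} (hA : A.IsHermitian)
    {Q : Matrix n n ℂ} (hQ : Q.PosSemidef) :
    ∃ w : n → ℝ, (∀ i, 0 ≤ w i) ∧ ∑ i, w i = Q.trace.re ∧ ∀ s t : ℝ,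
      (Q * NormedSpace.exp (s • A + t • A ^ 2)).trace.re =
        ∑ i, w i * Real.exp (s * hA.eigenvalues i + t * hA.eigenvalues i ^ 2) := by
  set U : Matrix n n ℂ := (hA.eigenvectorUnitary : Matrix n n ℂ) with hU
  have h2 : U * Uᴴ = 1 := Unitary.coe_mul_star_self hA.eigenvectorUnitary
  refine ⟨fun i => ((Uᴴ * Q * U) i i).re, fun i => ?_, ?_, fun s t => ?_⟩
  · exact (Complex.le_def.1 (hQ.conjTranspose_mul_mul_same U).diag_nonneg).1
  · rw [← Complex.re_sum]
    change (Uᴴ * Q * U).trace.re = _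
    rw [Matrix.mul_assoc, trace_mul_comm, Matrix.mul_assoc, h2, Matrix.mul_one]
  · rw [hA.exp_quadratic_eq, ← hU, ← Matrix.mul_assoc, trace_mul_comm, ← Matrix.mul_assoc,
      ← Matrix.mul_assoc, trace, Complex.re_sum]
    simp only [diag_apply, mul_diagonal, Complex.re_mul_ofReal]

/-- The trace of the exponential of a positive semidefinite matrix increases along scaling. -/
theorem PosSemidef.re_trace_exp_smul_mono {S : Matrix n n ℂ} (hS : S.PosSemidef) {s t : ℝ}
    (hst : s ≤ t) : (NormedSpace.exp (s • S)).trace.re ≤ (NormedSpace.exp (t • S)).trace.re := by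
  obtain ⟨w, hw, -, h⟩ := hS.isHermitian.re_trace_mul_exp_quadratic
    (PosSemidef.one (n := n) (R := ℂ))
  have hs := h s 0
  have ht := h t 0
  simp only [Matrix.one_mul, zero_smul, add_zero, zero_mul] at hs ht
  rw [hs, ht]
  refine Finset.sum_le_sum fun i _ => mul_le_mul_of_nonneg_left (Real.exp_le_exp.2 ?_) (hw i)
  exact mul_le_mul_of_nonneg_right hst (hS.eigenvalues_nonneg i)

/-! ### Averaging out the random coefficients. -/

theorem lintegral_re_trace_exp_add_le {ν : Measure ℝ}
    (hν : ∀ t : ℝ, ∫⁻ x, ENNReal.ofReal (Real.exp (t * x)) ∂ν ≤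
      ENNReal.ofReal (Real.exp (t ^ 2 / 2)))
    {H A : Matrix n n ℂ} (hH : H.IsHermitian) (hA : A.IsHermitian) :
    ∫⁻ x, ENNReal.ofReal
        (NormedSpace.exp (H + (x • A + (-1 / 2 : ℝ) • A ^ 2))).trace.re ∂ν ≤
      ENNReal.ofReal (NormedSpace.exp H).trace.re := by
  obtain ⟨w, hw, hsum, h⟩ := hA.re_trace_mul_exp_quadratic hH.posSemidef_exp
  have hone (a : ℝ) : ∫⁻ x, ENNReal.ofReal (Real.exp (x * a + -1 / 2 * a ^ 2)) ∂ν ≤ 1 := by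
    have h1 (x : ℝ) : ENNReal.ofReal (Real.exp (x * a + -1 / 2 * a ^ 2)) =
        ENNReal.ofReal (Real.exp (-(a ^ 2 / 2))) * ENNReal.ofReal (Real.exp (a * x)) := by
      rw [← ENNReal.ofReal_mul (Real.exp_pos _).le, ← Real.exp_add]
      congr 2; ring
    simp only [h1]
    rw [lintegral_const_mul _ (by fun_prop)]
    refine (mul_le_mul_right (hν a) _).trans_eq ?_
    rw [← ENNReal.ofReal_mul (Real.exp_pos _).le, ← Real.exp_add]
    simp
  calc _ ≤ ∫⁻ x, ∑ i, ENNReal.ofReal (w i) * ENNReal.ofReal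
          (Real.exp (x * hA.eigenvalues i + -1 / 2 * hA.eigenvalues i ^ 2)) ∂ν := by
        refine lintegral_mono fun x => ?_
        have hK : (x • A + (-1 / 2 : ℝ) • A ^ 2).IsHermitian :=
          (hA.real_smul _).add ((hA.pow 2).real_smul _)
        refine (ENNReal.ofReal_le_ofReal ((re_trace_exp_add_le hH hK).trans_eq (h _ _))).trans_eq ?_
        rw [ENNReal.ofReal_sum_of_nonneg fun i _ => mul_nonneg (hw i) (Real.exp_pos _).le]
        simp only [ENNReal.ofReal_mul (hw _)]
    _ = ∑ i, ENNReal.ofReal (w i) * ∫⁻ x, ENNReal.ofReal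
          (Real.exp (x * hA.eigenvalues i + -1 / 2 * hA.eigenvalues i ^ 2)) ∂ν := by
        rw [lintegral_finsetSum _ (by fun_prop)]
        refine Finset.sum_congr rfl fun i _ => lintegral_const_mul _ (by fun_prop)
    _ ≤ ∑ i, ENNReal.ofReal (w i) * 1 :=
        Finset.sum_le_sum fun i _ => mul_le_mul_right (hone _) _
    _ = _ := by
        simp only [mul_one]
        rw [← ENNReal.ofReal_sum_of_nonneg fun i _ => hw i, hsum]

/-- An arbitrary Hermitian H lets the induction absorb the first summand into H, average over the
others, and average over the first last. Lower integrals avoid assuming integrability, which is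
deduced from the bound. -/
theorem lintegral_pi_re_trace_exp_add_sum_le {N : ℕ} (ν : Fin N → Measure ℝ)
    [∀ p, IsProbabilityMeasure (ν p)]
    (hν : ∀ p, ∀ t : ℝ, ∫⁻ x, ENNReal.ofReal (Real.exp (t * x)) ∂(ν p) ≤
      ENNReal.ofReal (Real.exp (t ^ 2 / 2)))
    {A : Fin N → Matrix n n ℂ} (hA : ∀ p, (A p).IsHermitian) {H : Matrix n n ℂ}
    (hH : H.IsHermitian) :
    ∫⁻ x, ENNReal.ofReal
        (NormedSpace.exp (H + ∑ p, (x p • A p + (-1 / 2 : ℝ) • A p ^ 2))).trace.re ∂(Measure.pi ν) ≤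
      ENNReal.ofReal (NormedSpace.exp H).trace.re := by
  induction N generalizing H with
  | zero => simp
  | succ N ih =>
    have hmp := measurePreserving_piFinSuccAbove ν 0
    let F : ℝ × (Fin N → ℝ) → ℝ≥0∞ := fun z => ENNReal.ofReal (NormedSpace.exp
        ((H + (z.1 • A 0 + (-1 / 2 : ℝ) • A 0 ^ 2)) +
          ∑ p : Fin N, (z.2 p • A p.succ + (-1 / 2 : ℝ) • A p.succ ^ 2))).trace.re
    have hF : Measurable F :=
      (ENNReal.continuous_ofReal.comp (continuous_re_trace_exp.comp (by fun_prop))).measurable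
    have he (x : Fin (N + 1) → ℝ) : MeasurableEquiv.piFinSuccAbove (fun _ => ℝ) 0 x =
        (x 0, fun p => x p.succ) := rfl
    have hinner (y : ℝ) : ∫⁻ z, F (y, z) ∂(Measure.pi fun p : Fin N => ν p.succ) ≤ ENNReal.ofReal
        (NormedSpace.exp (H + (y • A 0 + (-1 / 2 : ℝ) • A 0 ^ 2))).trace.re := by
      have hHy : (H + (y • A 0 + (-1 / 2 : ℝ) • A 0 ^ 2)).IsHermitian :=
        hH.add (((hA 0).real_smul y).add (((hA 0).pow 2).real_smul _))
      have hi := ih (fun p => ν p.succ) (fun p => hν p.succ) (A := fun p => A p.succ)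
        (fun p => hA p.succ) hHy
      simp only [F]
      exact hi
    have hsplit := hmp.lintegral_comp hF
    simp only [he] at hsplit
    refine le_trans (le_of_eq ?_) ((lintegral_mono hinner).trans
      (lintegral_re_trace_exp_add_le (hν 0) hH (hA 0)))
    refine Eq.trans (lintegral_congr fun x => ?_)
      (hsplit.trans (lintegral_prod F hF.aemeasurable))
    simp only [F]
    rw [Fin.sum_univ_succ, ← add_assoc]

end Matrix

/-! ### Scalar moment generating functions and the conclusion. -/

theorem lintegral_exp_mul_rademacherLaw_le (t : ℝ) :
    ∫⁻ x, ENNReal.ofReal (Real.exp (t * x)) ∂rademacherLaw ≤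
      ENNReal.ofReal (Real.exp (t ^ 2 / 2)) := by
  have h2 : (2⁻¹ : ℝ≥0∞) = ENNReal.ofReal 2⁻¹ := by
    rw [ENNReal.ofReal_inv_of_pos two_pos]; simp
  rw [rademacherLaw, lintegral_add_measure, lintegral_smul_measure, lintegral_smul_measure,
    lintegral_dirac, lintegral_dirac, h2, smul_eq_mul, smul_eq_mul,
    ← ENNReal.ofReal_mul (by norm_num), ← ENNReal.ofReal_mul (by norm_num),
    ← ENNReal.ofReal_add (by positivity) (by positivity)]
  refine ENNReal.ofReal_le_ofReal (le_trans (le_of_eq ?_) (Real.cosh_le_exp_half_sq t))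
  rw [Real.cosh_eq]
  simp; ring

theorem lintegral_exp_mul_gaussianReal (t : ℝ) :
    ∫⁻ x, ENNReal.ofReal (Real.exp (t * x)) ∂(gaussianReal 0 1) =
      ENNReal.ofReal (Real.exp (t ^ 2 / 2)) := by
  rw [← ofReal_integral_eq_lintegral_ofReal (integrable_exp_mul_gaussianReal t)
    (Filter.Eventually.of_forall fun x => (Real.exp_pos _).le)]
  have h := congrFun (mgf_fun_id_gaussianReal (μ := 0) (v := 1)) t
  simp only [mgf] at h
  rw [h]
  simp

theorem mainTheorem6 {Ω : Type*} [MeasurableSpace Ω] (P : Measure Ω) [IsProbabilityMeasure P]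
    (N d : ℕ) (A : Fin N → Matrix (Fin d) (Fin d) ℂ) (hA : ∀ p, (A p).IsHermitian)
    (ε : Fin N → Ω → ℝ) (hindep : iIndepFun ε P)
    (hlaw : ∀ p, HasLaw (ε p) rademacherLaw P ∨ HasLaw (ε p) (gaussianReal 0 1) P)
    (μ : ℝ) :
    Integrable (fun ω => (NormedSpace.exp (μ • matrixSum ε A ω)).trace) P ∧
    (∫ ω, (NormedSpace.exp (μ • matrixSum ε A ω)).trace ∂P) ≤
      (NormedSpace.exp ((μ ^ 2 / 2) • ∑ p, A p ^ 2)).trace ∧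
    (∫ ω, (NormedSpace.exp (μ • matrixSum ε A ω)).trace ∂P) ≤
      (NormedSpace.exp (μ ^ 2 • ∑ p, A p ^ 2)).trace := by
  have hmeas (p : Fin N) : AEMeasurable (ε p) P :=
    (hlaw p).elim (fun h => h.aemeasurable) (fun h => h.aemeasurable)
  have hsub (p : Fin N) (t : ℝ) : ∫⁻ x, ENNReal.ofReal (Real.exp (t * x)) ∂(P.map (ε p)) ≤
      ENNReal.ofReal (Real.exp (t ^ 2 / 2)) := by
    rcases hlaw p with h | h
    · rw [h.map_eq]; exact lintegral_exp_mul_rademacherLaw_le t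
    · rw [h.map_eq]; exact (lintegral_exp_mul_gaussianReal t).le
  have hprob (p : Fin N) : IsProbabilityMeasure (P.map (ε p)) :=
    Measure.isProbabilityMeasure_map (hmeas p)
  have hvec : AEMeasurable (fun ω p => ε p ω) P := aemeasurable_pi_lambda _ hmeas
  have hS : (∑ p, A p ^ 2).PosSemidef := by
    refine Matrix.posSemidef_sum _ fun p _ => ?_
    have h := Matrix.posSemidef_conjTranspose_mul_self (A p)
    rwa [(hA p).eq, ← pow_two] at h
  have hH := hS.isHermitian.real_smul (μ ^ 2 / 2)
  have hZ (ω : Ω) : (μ • matrixSum ε A ω).IsHermitian :=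
    (Matrix.IsHermitian.sum _ fun p => (hA p).real_smul _).real_smul μ
  set f : Ω → ℝ := fun ω => (NormedSpace.exp (μ • matrixSum ε A ω)).trace.re
  have hf0 (ω : Ω) : 0 ≤ f ω := (hZ ω).re_trace_exp_nonneg
  have hfeq : (fun ω => (NormedSpace.exp (μ • matrixSum ε A ω)).trace) = fun ω => (f ω : ℂ) :=
    funext fun ω => (hZ ω).trace_exp_eq_re
  have hcont : Continuous fun x : Fin N → ℝ => (NormedSpace.exp (μ • ∑ p, x p • A p)).trace.re :=
    Matrix.continuous_re_trace_exp.comp (by fun_prop)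
  have hlint : ∫⁻ ω, ENNReal.ofReal (f ω) ∂P ≤
      ENNReal.ofReal (NormedSpace.exp ((μ ^ 2 / 2) • ∑ p, A p ^ 2)).trace.re := by
    have hbound := Matrix.lintegral_pi_re_trace_exp_add_sum_le (fun p => P.map (ε p)) hsub
      (fun p => (hA p).real_smul μ) hH
    refine le_trans (le_of_eq ?_) hbound
    -- Independence enters here: the joint law is the product of the marginals.
    rw [← (iIndepFun_iff_map_fun_eq_pi_map hmeas).1 hindep]
    have hcancel (x : Fin N → ℝ) : (μ ^ 2 / 2) • ∑ p, A p ^ 2 +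
        ∑ p, (x p • μ • A p + (-1 / 2 : ℝ) • (μ • A p) ^ 2) = μ • ∑ p, x p • A p := by
      rw [Finset.smul_sum, Finset.smul_sum, ← Finset.sum_add_distrib]
      refine Finset.sum_congr rfl fun p _ => ?_
      rw [smul_pow]
      module
    simp only [hcancel]
    exact (lintegral_map' (ENNReal.continuous_ofReal.comp hcont).measurable.aemeasurable hvec).symm
  have hfm : AEStronglyMeasurable f P :=
    (hcont.measurable.comp_aemeasurable hvec).aestronglyMeasurable
  have hint : Integrable f P :=
    (lintegral_ofReal_ne_top_iff_integrable hfm (Filter.Eventually.of_forall hf0)).1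
      (ne_top_of_le_ne_top ENNReal.ofReal_ne_top hlint)
  have hle : ∫ ω, f ω ∂P ≤ (NormedSpace.exp ((μ ^ 2 / 2) • ∑ p, A p ^ 2)).trace.re := by
    rw [integral_eq_lintegral_of_nonneg_ae (Filter.Eventually.of_forall hf0) hfm]
    exact ENNReal.toReal_le_of_le_ofReal hH.re_trace_exp_nonneg hlint
  have hmono := hS.re_trace_exp_smul_mono (s := μ ^ 2 / 2) (t := μ ^ 2) (by nlinarith [sq_nonneg μ])
  rw [hfeq, integral_complex_ofReal, hH.trace_exp_eq_re,
    (hS.isHermitian.real_smul (μ ^ 2)).trace_exp_eq_re]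
  exact ⟨hint.ofReal, Complex.real_le_real.2 hle, Complex.real_le_real.2 (hle.trans hmono)⟩
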